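/- Let $M,N\ge 1$, $m=\min(M,N)$, $n=\max(M,N)$. Consider the block-fading channel $Y=HS+W$ with $M$ transmit and $N$ receive antennas, where the $N\times M$ matrix $H$ has independent $\mathcal{CN}(0,1)$ entries, $W\sim\mathcal{CN}(0,I_N)$, and $H$ is known perfectly to transmitter and receiver. A (joint temporal and spatial) power control of average power $P$ is a measurable map $Q$ assigning to each channel matrix $H$ a positive semidefinite $M\times M$ covariance matrix $Q(H)$ of the Gaussian input $S$, with $\mathbb{E}[\operatorname{tr}Q(H)]\le P$. At rate $R$ it is in outage at $H$ if it does not transmit ($Q(H)=0$) or if $\log\det(I_N+HQ(H)H^\dagger)<R$. Let $\Pi(P,R)$ be the outage probability of optimal power control, i.e. the infimum of $\Pr\{Q\text{ is in outage at }H\}$ over all power controls $Q$ of average power $P$. (a) If $0\le r<m$ and $R(P)$ is any rate function with multiplexing gain $r$, i.e. $\lim_{P\to\infty}R(P)/\log P=r$ (in particular $R(P)=r\log P$), then the diversity order is infinite: $$\lim_{P\to\infty}-\frac{\log \Pi(P,R(P))}{\log P}=\infty .$$ (b) If $r=m$, $n>2m$ and $R(P)=m\log P$, then likewise $$\lim_{P\to\infty}-\frac{\log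 \Pi(P,m\log P)}{\log P}=\infty .$$ Here all logarithms have the same base, $\log 0=-\infty$, and a quotient whose numerator is $+\infty$ counts as $+\infty$. -/

import Mathlib

open MeasureTheory ProbabilityTheory Filter Topology
open scoped ENNReal Matrix ComplexOrder

noncomputable section

namespace MIMO

/-- Matrices carry the product sigma-algebra of their entries. -/
instance matrixMeasurableSpace (N M : ℕ) : MeasurableSpace (Matrix (Fin N) (Fin M) ℂ) :=
  inferInstanceAs (MeasurableSpace (Fin N → Fin M → ℂ))

/-- The standard circularly symmetric complex Gaussian law `CN(0,1)`: the real and the imaginary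
part are independent real Gaussians with mean `0` and variance `1/2`. -/
def complexGaussian : Measure ℂ :=
  ((gaussianReal 0 (1 / 2)).prod (gaussianReal 0 (1 / 2))).map
    (fun p : ℝ × ℝ => (⟨p.1, p.2⟩ : ℂ))

/-- The law of the `N × M` channel matrix (`M` transmit and `N` receive antennas): all entries are
independent with law `CN(0,1)`. -/
def channelLaw (N M : ℕ) : Measure (Matrix (Fin N) (Fin M) ℂ) :=
  Measure.pi fun _ : Fin N => Measure.pi fun _ : Fin M => complexGaussian

/-- A joint temporal and spatial power control with perfect channel state information at the
transmitter: it sends a Gaussian codeword whose covariance matrix `Q H` is an arbitrary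
(measurable) function of the channel matrix `H`, subject only to the long-term average power
constraint `E[tr (Q H)] ≤ P`. -/
structure IsPowerControl (N M : ℕ) (P : ℝ)
    (Q : Matrix (Fin N) (Fin M) ℂ → Matrix (Fin M) (Fin M) ℂ) : Prop where
  measurable : ∀ i j, Measurable fun H => Q H i j
  posSemidef : ∀ H, (Q H).PosSemidef
  power_le : ∫⁻ H, ENNReal.ofReal (Q H).trace.re ∂(channelLaw N M) ≤ ENNReal.ofReal P

/-- Mutual information `log det (I + H S Hᴴ)` of the channel `Y = H X + W`, with `W ∼ CN(0, I)`,
input `X ∼ CN(0, S)` and the realization `H` known to the receiver (the determinant is real). -/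
def mutualInfo {N M : ℕ} (H : Matrix (Fin N) (Fin M) ℂ) (S : Matrix (Fin M) (Fin M) ℂ) : ℝ :=
  Real.log (1 + H * S * Hᴴ).det.re

/-- Outage at rate `R`: either nothing is transmitted, or the mutual information of the
realized channel is smaller than the rate. -/
def outageEvent {N M : ℕ} (Q : Matrix (Fin N) (Fin M) ℂ → Matrix (Fin M) (Fin M) ℂ) (R : ℝ) :
    Set (Matrix (Fin N) (Fin M) ℂ) :=
  {H | Q H = 0 ∨ mutualInfo H (Q H) < R}

/-- The outage probability of the optimal power control with average power `P` and rate `R`: the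
infimum of the outage probabilities of all power controls. -/
def optimalOutage (N M : ℕ) (P R : ℝ) : ℝ≥0∞ :=
  ⨅ (Q : Matrix (Fin N) (Fin M) ℂ → Matrix (Fin M) (Fin M) ℂ) (_ : IsPowerControl N M P Q),
    channelLaw N M (outageEvent Q R)

/-- The rate function `R` has multiplexing gain `r`: `R P / log P → r` as `P → ∞`. -/
def HasMultiplexingGain (R : ℝ → ℝ) (r : ℝ) : Prop :=
  Tendsto (fun P => R P / Real.log P) atTop (𝓝 r)

/-- The outage probability `p`, as a function of the average power, has diversity order `d`:
`- log (p P) / log P → d` as `P → ∞`, in the extended reals, where `log 0 = -∞`. -/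
def HasDiversityOrder (p : ℝ → ℝ≥0∞) (d : EReal) : Prop :=
  Tendsto (fun P : ℝ => -ENNReal.log (p P) / ((Real.log P : ℝ) : EReal)) atTop (𝓝 d)

end MIMO

end

namespace MIMO

/-! Invert the channel. Let `A` be the `m × n` matrix among `H` and `Hᵀ`, and let `d i` be the
squared distance of its row `i` to the span of the other rows. A covariance that turns `H` into `m`
parallel unit channels of SNR `q` achieves rate `m * log (1 + q)` and costs `q * tr (A Aᴴ)⁻¹`, which
is at most `q * ∑ i, (d i)⁻¹`. So only the law of each single `d i` matters, and the joint
eigenvalue density is never needed.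

Given the other rows, `d i` dominates the squared norm of a standard Gaussian vector in dimension at
least `n - m + 1`, whence `E exp (-t d i) ≤ (1 + t)^(-(n - m + 1))`. Chernoff's bound gives `Pr (d i
< 1/T) ≤ e/T`. Integrating over `t` gives `E (d i)⁻¹ ≤ 1/(n - m)` if `m < n`, and a bound `2 log (1
+ T)` for the part with `d i ≥ 1/T` in all cases.

For `r < s < m`, inverting with `q = P^(s/m)` only where every `d i ≥ P^(-(K+1))` costs `P^(s/m)` up
to a logarithm, and outage is `O(P^(-(K+1)))` for each `K`. For `n > 2m`, inverting almost
everywhere with `q = P` costs at most `mP/(n - m) ≤ P`, and outage has probability zero. -/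

/-! ### Complex Gaussian vectors and their unitary invariance -/

instance isProbabilityMeasure_complexGaussian : IsProbabilityMeasure complexGaussian := by
  unfold complexGaussian
  refine Measure.isProbabilityMeasure_map (Measurable.aemeasurable ?_)
  exact Complex.measurableEquivRealProd.symm.measurable

theorem charFun_complexGaussian (t : ℂ) :
    charFun complexGaussian t = Complex.exp (-(‖t‖ ^ 2 : ℝ) / 4) := by
  have hm : Measurable (fun p : ℝ × ℝ => (⟨p.1, p.2⟩ : ℂ)) :=
    Complex.measurableEquivRealProd.symm.measurable
  have h1 := charFun_gaussianReal (μ := 0) (v := 1 / 2) t.re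
  have h2 := charFun_gaussianReal (μ := 0) (v := 1 / 2) t.im
  rw [charFun_apply_real] at h1 h2
  rw [charFun_apply, complexGaussian, integral_map hm.aemeasurable (by fun_prop)]
  have : ∀ p : ℝ × ℝ, Complex.exp (((inner ℝ (⟨p.1, p.2⟩ : ℂ) t : ℝ) : ℂ) * Complex.I)
      = Complex.exp (t.re * p.1 * Complex.I) * Complex.exp (t.im * p.2 * Complex.I) := by
    intro p
    rw [← Complex.exp_add]
    congr 1
    simp [Complex.inner]
    ring
  simp_rw [this]
  rw [integral_prod_mul (fun x : ℝ => Complex.exp (t.re * x * Complex.I))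
    (fun x : ℝ => Complex.exp (t.im * x * Complex.I)), h1, h2, ← Complex.exp_add]
  congr 1
  rw [Complex.sq_norm, Complex.normSq_apply]
  push_cast
  norm_num
  ring

/-- The law of a vector of independent `CN(0,1)` variables on the Euclidean space `ℂ^n`. -/
noncomputable def complexGaussianVec (n : ℕ) : Measure (EuclideanSpace ℂ (Fin n)) :=
  (Measure.pi fun _ : Fin n => complexGaussian).map (WithLp.toLp 2)

instance (n : ℕ) : IsProbabilityMeasure (complexGaussianVec n) :=
  Measure.isProbabilityMeasure_map (Measurable.aemeasurable (by fun_prop))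

theorem charFun_complexGaussianVec {n : ℕ} (t : EuclideanSpace ℂ (Fin n)) :
    charFun (complexGaussianVec n) t = Complex.exp (-(‖t‖ ^ 2 : ℝ) / 4) := by
  rw [complexGaussianVec, charFun_pi]
  simp_rw [charFun_complexGaussian]
  rw [← Complex.exp_sum, EuclideanSpace.norm_sq_eq]
  congr 1
  push_cast
  rw [← Finset.sum_div, Finset.sum_neg_distrib]

theorem real_inner_eq_re_complex_inner {n : ℕ} (x y : EuclideanSpace ℂ (Fin n)) :
    inner ℝ x y = (inner ℂ x y).re := by
  simp [PiLp.inner_apply, Complex.inner]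

/-- The characteristic function depends only on the norm, which `V` preserves, and the adjoint moves
to `V` in the inner product. -/
theorem map_adjoint_complexGaussianVec {k n : ℕ}
    (V : EuclideanSpace ℂ (Fin k) →ₗᵢ[ℂ] EuclideanSpace ℂ (Fin n)) :
    (complexGaussianVec n).map (ContinuousLinearMap.adjoint V.toContinuousLinearMap)
      = complexGaussianVec k := by
  have hm : Measurable (ContinuousLinearMap.adjoint V.toContinuousLinearMap) :=
    (ContinuousLinearMap.continuous _).measurable
  have : IsProbabilityMeasure
      ((complexGaussianVec n).map (ContinuousLinearMap.adjoint V.toContinuousLinearMap)) :=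
    Measure.isProbabilityMeasure_map hm.aemeasurable
  apply Measure.ext_of_charFun
  ext s
  rw [charFun_complexGaussianVec, ← V.norm_map s, ← charFun_complexGaussianVec,
    charFun_apply, charFun_apply, integral_map hm.aemeasurable (by fun_prop)]
  congr 1
  ext x
  congr 3
  rw [real_inner_eq_re_complex_inner, real_inner_eq_re_complex_inner,
    ContinuousLinearMap.adjoint_inner_left]
  rfl

/-! ### Laplace transform of the squared norm -/

theorem integral_exp_neg_mul_sq_gaussianReal {t : ℝ} (ht : 0 ≤ t) :
    ∫ x, Real.exp (-t * x ^ 2) ∂(gaussianReal 0 (1 / 2)) = (√(1 + t))⁻¹ := by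
  rw [integral_gaussianReal_eq_integral_smul (by norm_num)]
  have : ∀ x : ℝ, gaussianPDFReal 0 (1 / 2) x • Real.exp (-t * x ^ 2)
      = (√Real.pi)⁻¹ * Real.exp (-(1 + t) * x ^ 2) := by
    intro x
    rw [gaussianPDFReal, smul_eq_mul, mul_assoc, ← Real.exp_add]
    congr 2
    · norm_num
      rw [mul_right_comm, mul_inv_cancel₀ (by positivity), one_mul]
    · norm_num; ring
  simp_rw [this]
  rw [integral_const_mul, integral_gaussian, Real.sqrt_div Real.pi_pos.le]
  field_simp [Real.pi_pos.ne', (Real.sqrt_pos.2 Real.pi_pos).ne']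

theorem lintegral_exp_neg_mul_sq_gaussianReal {t : ℝ} (ht : 0 ≤ t) :
    ∫⁻ x, ENNReal.ofReal (Real.exp (-t * x ^ 2)) ∂(gaussianReal 0 (1 / 2))
      = ENNReal.ofReal (√(1 + t))⁻¹ := by
  rw [← integral_exp_neg_mul_sq_gaussianReal ht, ofReal_integral_eq_lintegral_ofReal]
  · refine Integrable.of_bound (C := 1) (by fun_prop) (ae_of_all _ fun x => ?_)
    rw [Real.norm_eq_abs, Real.abs_exp, Real.exp_le_one_iff]
    nlinarith [sq_nonneg x]
  · exact ae_of_all _ fun x => (Real.exp_pos _).le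

theorem lintegral_exp_neg_mul_sq_complexGaussian {t : ℝ} (ht : 0 ≤ t) :
    ∫⁻ z, ENNReal.ofReal (Real.exp (-t * ‖z‖ ^ 2)) ∂complexGaussian
      = ENNReal.ofReal (1 + t)⁻¹ := by
  have hm : Measurable (fun p : ℝ × ℝ => (⟨p.1, p.2⟩ : ℂ)) :=
    Complex.measurableEquivRealProd.symm.measurable
  rw [complexGaussian, lintegral_map (by fun_prop) hm]
  have : ∀ p : ℝ × ℝ, ENNReal.ofReal (Real.exp (-t * ‖(⟨p.1, p.2⟩ : ℂ)‖ ^ 2))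
      = ENNReal.ofReal (Real.exp (-t * p.1 ^ 2)) * ENNReal.ofReal (Real.exp (-t * p.2 ^ 2)) := by
    intro p
    rw [← ENNReal.ofReal_mul (Real.exp_pos _).le, ← Real.exp_add, Complex.sq_norm,
      Complex.normSq_apply]
    ring_nf
  simp_rw [this]
  rw [lintegral_prod_mul (f := fun x : ℝ => ENNReal.ofReal (Real.exp (-t * x ^ 2)))
    (g := fun x : ℝ => ENNReal.ofReal (Real.exp (-t * x ^ 2))) (by fun_prop) (by fun_prop),
    lintegral_exp_neg_mul_sq_gaussianReal ht, ← ENNReal.ofReal_mul (by positivity),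
    ← mul_inv, Real.mul_self_sqrt (by linarith)]

theorem lintegral_exp_neg_mul_sq_complexGaussianVec (n : ℕ) {t : ℝ} (ht : 0 ≤ t) :
    ∫⁻ x, ENNReal.ofReal (Real.exp (-t * ‖x‖ ^ 2)) ∂complexGaussianVec n
      = ENNReal.ofReal ((1 + t) ^ n)⁻¹ := by
  rw [complexGaussianVec, lintegral_map (by fun_prop) (by fun_prop)]
  have : ∀ x : Fin n → ℂ, ENNReal.ofReal (Real.exp (-t * ‖WithLp.toLp 2 x‖ ^ 2))
      = ∏ i, ENNReal.ofReal (Real.exp (-t * ‖x i‖ ^ 2)) := by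
    intro x
    rw [← ENNReal.ofReal_prod_of_nonneg (fun i _ => (Real.exp_pos _).le), ← Real.exp_sum,
      EuclideanSpace.norm_sq_eq, Finset.mul_sum]
  simp_rw [this]
  have hind := iIndepFun_pi (μ := fun _ : Fin n => complexGaussian)
    (X := fun _ (z : ℂ) => ENNReal.ofReal (Real.exp (-t * ‖z‖ ^ 2))) (fun i => by fun_prop)
  rw [lintegral_prod_eq_prod_lintegral_of_indepFun _ _ hind fun i => by fun_prop]
  have (i : Fin n) : ∫⁻ x, ENNReal.ofReal (Real.exp (-t * ‖x i‖ ^ 2))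
      ∂(Measure.pi fun _ : Fin n => complexGaussian) = ENNReal.ofReal (1 + t)⁻¹ := by
    rw [← lintegral_exp_neg_mul_sq_complexGaussian ht]
    exact (measurePreserving_eval (fun _ : Fin n => complexGaussian) i).lintegral_comp
      (f := fun z => ENNReal.ofReal (Real.exp (-t * ‖z‖ ^ 2))) (by fun_prop)
  simp_rw [this]
  rw [Finset.prod_const, Finset.card_univ, Fintype.card_fin, ← ENNReal.ofReal_pow (by positivity),
    inv_pow]

/-! ### Distance of a row to the span of the others -/

/-- The squared Euclidean distance of the row `A i` to the span of the other rows of `A`. -/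
noncomputable def rowSqDist {m n : ℕ} (i : Fin m) (A : Matrix (Fin m) (Fin n) ℂ) : ℝ :=
  ⨅ c : Fin m → ℂ,
    ‖(WithLp.toLp 2 (A i - ∑ j ∈ Finset.univ.erase i, c j • A j) : EuclideanSpace ℂ (Fin n))‖ ^ 2

theorem bddBelow_rowSqDist {m n : ℕ} (i : Fin m) (A : Matrix (Fin m) (Fin n) ℂ) :
    BddBelow (Set.range fun c : Fin m → ℂ => ‖(WithLp.toLp 2
      (A i - ∑ j ∈ Finset.univ.erase i, c j • A j) : EuclideanSpace ℂ (Fin n))‖ ^ 2) :=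
  ⟨0, by rintro _ ⟨c, rfl⟩; positivity⟩

theorem rowSqDist_nonneg {m n : ℕ} (i : Fin m) (A : Matrix (Fin m) (Fin n) ℂ) :
    0 ≤ rowSqDist i A :=
  Real.iInf_nonneg fun _ => by positivity

theorem rowSqDist_le {m n : ℕ} (i : Fin m) (A : Matrix (Fin m) (Fin n) ℂ) (c : Fin m → ℂ) :
    rowSqDist i A ≤ ‖(WithLp.toLp 2
      (A i - ∑ j ∈ Finset.univ.erase i, c j • A j) : EuclideanSpace ℂ (Fin n))‖ ^ 2 :=
  ciInf_le (bddBelow_rowSqDist i A) c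

instance borelSpace_matrix (m n : ℕ) : BorelSpace (Matrix (Fin m) (Fin n) ℂ) :=
  inferInstanceAs (BorelSpace (Fin m → Fin n → ℂ))

/-- The infimum is over uncountably many `c`, so measurability comes from upper semicontinuity of an
infimum of continuous functions. -/
theorem measurable_rowSqDist {m n : ℕ} (i : Fin m) :
    Measurable (rowSqDist i : Matrix (Fin m) (Fin n) ℂ → ℝ) := by
  refine UpperSemicontinuous.measurable ?_
  refine upperSemicontinuous_ciInf (fun A => bddBelow_rowSqDist i A) fun c => ?_
  refine Continuous.upperSemicontinuous ?_
  have h (j : Fin m) : Continuous fun A : Matrix (Fin m) (Fin n) ℂ => A j := continuous_apply j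
  have h' : Continuous fun A : Matrix (Fin m) (Fin n) ℂ =>
      A i - ∑ j ∈ Finset.univ.erase i, c j • A j :=
    (h i).sub (continuous_finsetSum _ fun j _ => (continuous_const_smul (c j)).comp (h j))
  exact (((PiLp.continuous_toLp 2 _).comp h').norm).pow 2

instance isProbabilityMeasure_channelLaw (m n : ℕ) : IsProbabilityMeasure (channelLaw m n) := by
  change IsProbabilityMeasure (Measure.pi fun _ : Fin m =>
    (Measure.pi fun _ : Fin n => complexGaussian : Measure (Fin n → ℂ)))
  infer_instance

/-- With the other rows frozen, projecting row `i` to the orthogonal complement of their span kills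
every linear combination of them and does not increase norms. The projection is again standard
Gaussian. The frozen rows may be dependent, so the dimension is only bounded below by `k`. -/
theorem lintegral_exp_neg_mul_rowSqDist_update {m n k : ℕ} (hk : m + k ≤ n + 1) (i : Fin m)
    (A : Fin m → Fin n → ℂ) {t : ℝ} (ht : 0 ≤ t) :
    ∫⁻ y, ENNReal.ofReal (Real.exp (-t * rowSqDist i (Function.update A i y)))
      ∂(Measure.pi fun _ : Fin n => complexGaussian) ≤ ENNReal.ofReal ((1 + t) ^ k)⁻¹ := by
  classical
  let E := EuclideanSpace ℂ (Fin n)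
  let S : Submodule ℂ E := Submodule.span ℂ
    ((Finset.univ.erase i).image fun j => (WithLp.toLp 2 (A j) : E))
  have hS : Module.finrank ℂ S ≤ m - 1 := by
    refine (finrank_span_finset_le_card _).trans (Finset.card_image_le.trans ?_)
    simp
  have hSo : k ≤ Module.finrank ℂ Sᗮ := by
    have := Submodule.finrank_add_finrank_orthogonal S
    rw [finrank_euclideanSpace_fin] at this
    have := i.pos
    omega
  set d := Module.finrank ℂ Sᗮ with hd
  -- `V` parametrizes `Sᗮ` isometrically; its adjoint `T` is the orthogonal projection to `Sᗮ` in
  -- these coordinates.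
  let V : EuclideanSpace ℂ (Fin d) →ₗᵢ[ℂ] E :=
    Sᗮ.subtypeₗᵢ.comp (stdOrthonormalBasis ℂ Sᗮ).repr.symm.toLinearIsometry
  let T := ContinuousLinearMap.adjoint V.toContinuousLinearMap
  have hT : ∀ x : E, ‖T x‖ ≤ ‖x‖ := by
    intro x
    have h1 := T.le_opNorm x
    have h2 : ‖T‖ ≤ 1 := by
      rw [LinearIsometryEquiv.norm_map]
      exact V.norm_toContinuousLinearMap_le
    nlinarith [norm_nonneg x]
  have hT0 : ∀ j ∈ Finset.univ.erase i, T (WithLp.toLp 2 (A j)) = 0 := by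
    intro j hj
    refine ext_inner_right ℂ fun s => ?_
    rw [ContinuousLinearMap.adjoint_inner_left, inner_zero_left]
    have h1 : V s ∈ Sᗮ := ((stdOrthonormalBasis ℂ Sᗮ).repr.symm s).2
    exact h1 _ (Submodule.subset_span (Finset.mem_coe.2 (Finset.mem_image_of_mem _ hj)))
  have hdist : ∀ y : Fin n → ℂ, ‖T (WithLp.toLp 2 y)‖ ^ 2
      ≤ rowSqDist i (Function.update A i y) := by
    intro y
    refine le_ciInf fun c => ?_
    refine le_trans (le_of_eq ?_) (pow_le_pow_left₀ (norm_nonneg _) (hT _) 2)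
    congr 2
    have hself : Function.update A i y i = y := Function.update_self ..
    erw [hself]
    rw [WithLp.toLp_sub, WithLp.toLp_sum, map_sub, map_sum, Finset.sum_eq_zero, sub_zero]
    intro j hj
    erw [Function.update_of_ne (Finset.ne_of_mem_erase hj)]
    rw [WithLp.toLp_smul, map_smul, hT0 j hj,
      smul_zero]
  calc _ ≤ ∫⁻ y, ENNReal.ofReal (Real.exp (-t * ‖T (WithLp.toLp 2 y)‖ ^ 2))
      ∂(Measure.pi fun _ : Fin n => complexGaussian) := by
        refine lintegral_mono fun y => ENNReal.ofReal_le_ofReal (Real.exp_le_exp.2 ?_)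
        nlinarith [hdist y]
    _ = ∫⁻ x, ENNReal.ofReal (Real.exp (-t * ‖x‖ ^ 2)) ∂complexGaussianVec d := by
        rw [← map_adjoint_complexGaussianVec V, lintegral_map (by fun_prop) (by fun_prop),
          complexGaussianVec, lintegral_map (by fun_prop) (by fun_prop)]
    _ = ENNReal.ofReal ((1 + t) ^ d)⁻¹ := lintegral_exp_neg_mul_sq_complexGaussianVec d ht
    _ ≤ _ := by
        refine ENNReal.ofReal_le_ofReal (inv_anti₀ (by positivity) ?_)
        exact pow_le_pow_right₀ (by linarith) hSo

theorem lintegral_exp_neg_mul_rowSqDist {m n k : ℕ} (hk : m + k ≤ n + 1) (i : Fin m)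
    {t : ℝ} (ht : 0 ≤ t) :
    ∫⁻ A, ENNReal.ofReal (Real.exp (-t * rowSqDist i A)) ∂channelLaw m n
      ≤ ENNReal.ofReal ((1 + t) ^ k)⁻¹ := by
  have hmeas : Measurable fun A : Fin m → Fin n → ℂ =>
      ENNReal.ofReal (Real.exp (-t * rowSqDist i A)) :=
    ENNReal.measurable_ofReal.comp
      (Real.measurable_exp.comp ((measurable_rowSqDist (n := n) i).const_mul (-t)))
  change ∫⁻ A : Fin m → Fin n → ℂ, ENNReal.ofReal (Real.exp (-t * rowSqDist i A))
    ∂(Measure.pi fun _ : Fin m => Measure.pi fun _ : Fin n => complexGaussian) ≤ _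
  -- Integrate over row `i` first; the resulting bound is uniform in the other rows.
  rw [lintegral_eq_lmarginal_univ (0 : Fin m → Fin n → ℂ),
    lmarginal_erase' _ hmeas (Finset.mem_univ i)]
  refine (lmarginal_mono (g := fun _ => ENNReal.ofReal ((1 + t) ^ k)⁻¹)
    (fun A => lintegral_exp_neg_mul_rowSqDist_update hk i A ht) _).trans ?_
  simp [lmarginal]

/-! ### Tail and inverse moments of the row distance -/

theorem channelLaw_rowSqDist_lt_le {m n : ℕ} (hmn : m ≤ n) (i : Fin m) {T : ℝ} (hT : 0 < T) :
    channelLaw m n {A | rowSqDist i A < T⁻¹} ≤ ENNReal.ofReal (Real.exp 1 / T) := by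
  have hmeas : MeasurableSet {A : Matrix (Fin m) (Fin n) ℂ | rowSqDist i A < T⁻¹} :=
    measurableSet_lt (measurable_rowSqDist i) measurable_const
  rw [← lintegral_indicator_one hmeas]
  calc _ ≤ ∫⁻ A, ENNReal.ofReal (Real.exp 1) *
        ENNReal.ofReal (Real.exp (-T * rowSqDist i A)) ∂channelLaw m n := by
        refine lintegral_mono (Set.indicator_le fun A hA => ?_)
        rw [← ENNReal.ofReal_mul (Real.exp_pos _).le, ← Real.exp_add, Pi.one_apply,
          ← ENNReal.ofReal_one]
        refine ENNReal.ofReal_le_ofReal (Real.one_le_exp ?_)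
        have : rowSqDist i A * T < 1 := by rwa [← lt_div_iff₀ hT, one_div]
        linarith
    _ ≤ ENNReal.ofReal (Real.exp 1) * ENNReal.ofReal ((1 + T) ^ 1)⁻¹ := by
        rw [lintegral_const_mul' _ _ ENNReal.ofReal_ne_top]
        gcongr
        exact lintegral_exp_neg_mul_rowSqDist (by omega) i hT.le
    _ ≤ _ := by
        rw [← ENNReal.ofReal_mul (Real.exp_pos _).le, div_eq_mul_inv, pow_one]
        refine ENNReal.ofReal_le_ofReal (mul_le_mul_of_nonneg_left ?_ (Real.exp_pos _).le)
        exact inv_anti₀ hT (by linarith)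

theorem channelLaw_rowSqDist_eq_zero {m n : ℕ} (hmn : m ≤ n) (i : Fin m) :
    channelLaw m n {A | rowSqDist i A = 0} = 0 := by
  have h : ∀ᶠ T : ℝ in atTop, channelLaw m n {A | rowSqDist i A = 0}
      ≤ ENNReal.ofReal (Real.exp 1 / T) := by
    filter_upwards [eventually_gt_atTop 0] with T hT
    refine (measure_mono fun A hA => ?_).trans (channelLaw_rowSqDist_lt_le hmn i hT)
    have hA : rowSqDist i A = 0 := hA
    change rowSqDist i A < T⁻¹
    rw [hA]; positivity
  have hlim : Tendsto (fun T : ℝ => ENNReal.ofReal (Real.exp 1 / T)) atTop (𝓝 0) := by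
    rw [← ENNReal.ofReal_zero]
    exact ENNReal.tendsto_ofReal (tendsto_const_nhds.div_atTop tendsto_id)
  exact le_antisymm (ge_of_tendsto hlim h) bot_le

/-- Tonelli's theorem for the exponential moments of a nonnegative function. -/
theorem lintegral_setLIntegral_exp_le {m n k : ℕ} (hk : m + k ≤ n + 1) (i : Fin m) {s : Set ℝ}
    (hs : MeasurableSet s) (hs0 : s ⊆ Set.Ici 0) :
    ∫⁻ A, (∫⁻ t in s, ENNReal.ofReal (Real.exp (-t * rowSqDist i A))) ∂channelLaw m n
      ≤ ∫⁻ t in s, ENNReal.ofReal ((1 + t) ^ k)⁻¹ := by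
  rw [lintegral_lintegral_swap]
  · refine setLIntegral_mono' hs fun t ht => ?_
    exact lintegral_exp_neg_mul_rowSqDist hk i (hs0 ht)
  · have := (measurable_rowSqDist (n := n) i).comp
      (measurable_fst : Measurable (Prod.fst : Matrix (Fin m) (Fin n) ℂ × ℝ → _))
    refine Measurable.aemeasurable ?_
    refine ENNReal.measurable_ofReal.comp (Real.measurable_exp.comp ?_)
    exact (measurable_snd.neg).mul this

theorem lintegral_inv_one_add_pow {k : ℕ} (hk : 0 < k) :
    ∫⁻ t in Set.Ioi (0 : ℝ), ENNReal.ofReal ((1 + t) ^ (k + 1))⁻¹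
      = ENNReal.ofReal (k : ℝ)⁻¹ := by
  have hk' : (0 : ℝ) < k := by exact_mod_cast hk
  have hderiv : ∀ x ∈ Set.Ici (0 : ℝ),
      HasDerivAt (fun t : ℝ => -((k : ℝ) * (1 + t) ^ k)⁻¹) ((1 + x) ^ (k + 1))⁻¹ x := by
    intro x hx
    have hx : (0 : ℝ) < 1 + x := by have : (0 : ℝ) ≤ x := hx; linarith
    have h1 : HasDerivAt (fun t : ℝ => (k : ℝ) * (1 + t) ^ k)
        ((k : ℝ) * (k * (1 + x) ^ (k - 1) * 1)) x :=
      (((hasDerivAt_id x).const_add 1).pow k).const_mul _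
    have h2 := (h1.inv (by positivity)).neg
    convert! h2 using 1
    obtain ⟨j, rfl⟩ := Nat.exists_eq_succ_of_ne_zero hk.ne'
    simp only [Nat.succ_eq_add_one, Nat.add_sub_cancel]
    field_simp
    ring
  have hlim : Tendsto (fun t : ℝ => -((k : ℝ) * (1 + t) ^ k)⁻¹) atTop (𝓝 0) := by
    rw [← neg_zero]
    refine Tendsto.neg (tendsto_inv_atTop_zero.comp ?_)
    refine Tendsto.const_mul_atTop hk' ?_
    exact (tendsto_pow_atTop hk.ne').comp (tendsto_atTop_add_const_left _ _ tendsto_id)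
  have hpos : ∀ x ∈ Set.Ioi (0 : ℝ), 0 ≤ ((1 + x) ^ (k + 1))⁻¹ := by
    intro x hx
    have : (0 : ℝ) < x := hx
    positivity
  have hint := integrableOn_Ioi_deriv_of_nonneg' hderiv hpos hlim
  have hval := integral_Ioi_of_hasDerivAt_of_nonneg' hderiv hpos hlim
  rw [← ofReal_integral_eq_lintegral_ofReal hint
    ((ae_restrict_iff' measurableSet_Ioi).2 (ae_of_all _ hpos)), hval]
  simp

/-- Integrate `d⁻¹ = ∫ exp (-t d) dt` over the channel; the exponent `n - m + 1 ≥ 2` makes the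
integral in `t` converge. -/
theorem lintegral_inv_rowSqDist_le {m n : ℕ} (hmn : m < n) (i : Fin m) :
    ∫⁻ A, ENNReal.ofReal (rowSqDist i A)⁻¹ ∂channelLaw m n
      ≤ ENNReal.ofReal ((n : ℝ) - m)⁻¹ := by
  obtain ⟨k, rfl⟩ := Nat.exists_eq_add_of_lt hmn
  have h1 := lintegral_setLIntegral_exp_le (m := m) (n := m + k + 1) (k := k + 1 + 1) (by omega) i
    measurableSet_Ioi Set.Ioi_subset_Ici_self
  rw [lintegral_inv_one_add_pow (Nat.succ_pos k)] at h1
  refine (lintegral_mono fun A => ?_).trans (h1.trans (le_of_eq ?_))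
  · rcases (rowSqDist_nonneg i A).eq_or_lt with h0 | h0
    -- At distance zero the real inverse is `0`, so the bound is trivial there.
    · simp [← h0]
    have hint : IntegrableOn (fun t => Real.exp (-t * rowSqDist i A)) (Set.Ioi 0) := by
      simpa [mul_comm, neg_mul] using
        (integrableOn_exp_mul_Ioi (a := -rowSqDist i A) (by linarith) 0)
    have hval : ∫ t in Set.Ioi 0, Real.exp (-t * rowSqDist i A) = (rowSqDist i A)⁻¹ := by
      have := integral_exp_mul_Ioi (a := -rowSqDist i A) (by linarith) 0
      simpa [mul_comm, neg_mul] using this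
    rw [← hval, ofReal_integral_eq_lintegral_ofReal hint
      (ae_of_all _ fun t => (Real.exp_pos _).le)]
  · congr 2
    push_cast
    ring

/-- If `T * d ≥ 1`, cutting `∫ exp (-t d) dt` at `T` loses at most half of `d⁻¹`, which is the
factor `2`. The exponent `k = 1` then suffices, so square channels are covered. -/
theorem setLIntegral_inv_rowSqDist_le {m n : ℕ} (hmn : m ≤ n) (i : Fin m) {T : ℝ} (hT : 0 < T) :
    ∫⁻ A in {A | T⁻¹ ≤ rowSqDist i A}, ENNReal.ofReal (rowSqDist i A)⁻¹ ∂channelLaw m n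
      ≤ ENNReal.ofReal (2 * Real.log (1 + T)) := by
  have hmeas : MeasurableSet {A : Matrix (Fin m) (Fin n) ℂ | T⁻¹ ≤ rowSqDist i A} :=
    measurableSet_le measurable_const (measurable_rowSqDist i)
  have h1 := lintegral_setLIntegral_exp_le (m := m) (n := n) (k := 1) (by omega) i
    (measurableSet_Ioc (a := 0) (b := T)) (fun t ht => ht.1.le)
  have h2 : ∫⁻ t in Set.Ioc 0 T, ENNReal.ofReal ((1 + t) ^ 1)⁻¹
      = ENNReal.ofReal (Real.log (1 + T)) := by
    have hderiv : ∀ x ∈ Set.uIcc 0 T,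
        HasDerivAt (fun t : ℝ => Real.log (1 + t)) ((1 + x) ^ 1)⁻¹ x := by
      intro x hx
      rw [Set.uIcc_of_le hT.le] at hx
      have := ((hasDerivAt_id x).const_add 1).log (by have := hx.1; simp; linarith)
      simpa using this
    have hcont : ContinuousOn (fun t : ℝ => ((1 + t) ^ 1)⁻¹) (Set.uIcc 0 T) := by
      refine ContinuousOn.inv₀ (by fun_prop) fun x hx => ?_
      rw [Set.uIcc_of_le hT.le] at hx
      have := hx.1
      positivity
    have hval := intervalIntegral.integral_eq_sub_of_hasDerivAt hderiv hcont.intervalIntegrable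
    rw [intervalIntegral.integral_of_le hT.le] at hval
    rw [← ofReal_integral_eq_lintegral_ofReal, hval]
    · simp
    · exact (intervalIntegrable_iff_integrableOn_Ioc_of_le hT.le).1 hcont.intervalIntegrable
    · refine (ae_restrict_iff' measurableSet_Ioc).2 (ae_of_all _ fun t ht => ?_)
      have := ht.1
      simp only [Pi.zero_apply]
      positivity
  rw [h2] at h1
  calc _ ≤ ∫⁻ A in {A | T⁻¹ ≤ rowSqDist i A}, 2 *
        (∫⁻ t in Set.Ioc 0 T, ENNReal.ofReal (Real.exp (-t * rowSqDist i A))) ∂channelLaw m n := by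
        refine setLIntegral_mono' hmeas fun A hA => ?_
        have hA : T⁻¹ ≤ rowSqDist i A := hA
        set d := rowSqDist i A
        have hd : 0 < d := (inv_pos.2 hT).trans_le hA
        have hTd : 1 ≤ d * T := by rwa [inv_le_iff_one_le_mul₀ hT] at hA
        have hderiv : ∀ x ∈ Set.uIcc 0 T,
            HasDerivAt (fun t : ℝ => -(Real.exp (-t * d) / d)) (Real.exp (-x * d)) x := by
          intro x hx
          have := ((((hasDerivAt_id x).neg.mul_const d).exp).div_const d).neg
          convert! this using 1
          simp
          field_simp
        have hcont : ContinuousOn (fun t : ℝ => Real.exp (-t * d)) (Set.uIcc 0 T) := by fun_prop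
        have hval := intervalIntegral.integral_eq_sub_of_hasDerivAt hderiv hcont.intervalIntegrable
        rw [intervalIntegral.integral_of_le hT.le] at hval
        rw [← ofReal_integral_eq_lintegral_ofReal
          ((intervalIntegrable_iff_integrableOn_Ioc_of_le hT.le).1 hcont.intervalIntegrable)
          (ae_of_all _ fun t => (Real.exp_pos _).le), hval, ← ENNReal.ofReal_ofNat,
          ← ENNReal.ofReal_mul (by norm_num)]
        refine ENNReal.ofReal_le_ofReal ?_
        have he : Real.exp (-T * d) ≤ 1 / 2 := by
          rw [neg_mul, Real.exp_neg, one_div]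
          refine inv_anti₀ (by norm_num) ?_
          have := Real.add_one_le_exp (T * d)
          linarith
        simp only [neg_zero, zero_mul, Real.exp_zero]
        have : 2 * (-(Real.exp (-T * d) / d) - -(1 / d)) = (2 - 2 * Real.exp (-T * d)) / d := by
          ring
        rw [this, inv_eq_one_div]
        exact div_le_div_of_nonneg_right (by linarith) hd.le
    _ ≤ ∫⁻ A, 2 *
        (∫⁻ t in Set.Ioc 0 T, ENNReal.ofReal (Real.exp (-t * rowSqDist i A))) ∂channelLaw m n :=
        setLIntegral_le_lintegral _ _
    _ ≤ _ := by
        rw [lintegral_const_mul' _ _ (by norm_num), ENNReal.ofReal_mul (by norm_num),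
          ENNReal.ofReal_ofNat]
        gcongr

/-! ### Transposition and the Gram matrix -/

theorem map_transpose_channelLaw (M N : ℕ) :
    (channelLaw N M).map Matrix.transpose = channelLaw M N := by
  have hm : Measurable (Matrix.transpose : Matrix (Fin N) (Fin M) ℂ → Matrix (Fin M) (Fin N) ℂ) :=
    continuous_id.matrix_transpose.measurable
  symm
  refine Measure.pi_eq_generateFrom (fun _ => generateFrom_pi) (fun _ => isPiSystem_pi)
    (fun _ => ⟨fun _ => Set.univ, fun _ => ⟨fun _ => Set.univ, by simp, by simp⟩,
      fun _ => measure_lt_top _ _, Set.iUnion_const _⟩) fun s hs => ?_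
  choose t ht hts using hs
  have ht : ∀ i j, MeasurableSet (t i j) := fun i j => ht i j (Set.mem_univ j)
  obtain rfl : (fun i => Set.univ.pi (t i)) = s := funext hts
  have hpre : Matrix.transpose ⁻¹' (Set.univ.pi fun i => Set.univ.pi (t i))
      = Set.univ.pi fun j : Fin N => Set.univ.pi fun i : Fin M => t i j := by
    ext A
    exact ⟨fun h j _ i _ => h i trivial j trivial, fun h i _ j _ => h j trivial i trivial⟩
  have hbox (a b : ℕ) (u : Fin a → Fin b → Set ℂ) :
      (Measure.pi fun _ : Fin a => (Measure.pi fun _ : Fin b => complexGaussian :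
        Measure (Fin b → ℂ))) (Set.univ.pi fun i => Set.univ.pi (u i))
        = ∏ i, ∏ j, complexGaussian (u i j) := by
    simp only [Measure.pi_pi]
  erw [Measure.map_apply hm
    (MeasurableSet.univ_pi fun i => MeasurableSet.univ_pi fun j => ht i j), hpre]
  refine (hbox N M fun j i => t i j).trans ?_
  rw [Finset.prod_comm]
  exact Finset.prod_congr rfl fun i _ => (Measure.pi_pi _ _).symm

theorem posDef_mul_conjTranspose_of_rowSqDist_pos {m n : ℕ} {A : Matrix (Fin m) (Fin n) ℂ}
    (hA : ∀ i, 0 < rowSqDist i A) : (A * Aᴴ).PosDef := by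
  refine Matrix.PosDef.mul_conjTranspose_self A ?_
  rw [← Matrix.coe_vecMulLinear, ← LinearMap.ker_eq_bot, LinearMap.ker_eq_bot']
  intro v hv
  by_contra hne
  obtain ⟨i, hi⟩ := Function.ne_iff.1 hne
  have hi : v i ≠ 0 := hi
  have hrow : A i - ∑ j ∈ Finset.univ.erase i, (-(v j / v i)) • A j = 0 := by
    have h0 : ∑ j, v j • A j = 0 := by
      rw [← Matrix.vecMul_eq_sum]; exact hv
    rw [← Finset.add_sum_erase _ _ (Finset.mem_univ i)] at h0
    have h1 : (v i)⁻¹ • (v i • A i + ∑ j ∈ Finset.univ.erase i, v j • A j) = 0 := by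
      rw [h0, smul_zero]
    rw [smul_add, inv_smul_smul₀ hi, Finset.smul_sum] at h1
    rw [← h1, sub_eq_add_neg, ← Finset.sum_neg_distrib]
    congr 1
    refine Finset.sum_congr rfl fun j _ => ?_
    rw [neg_smul, neg_neg, smul_smul, div_eq_inv_mul]
  have h := rowSqDist_le i A fun j => -(v j / v i)
  rw [hrow] at h
  simp only [WithLp.toLp_zero, norm_zero] at h
  linarith [hA i]

/-- With `B = (A Aᴴ)⁻¹` and `g = B i i`, row `i` of `B * A` has squared norm `(B A Aᴴ B) i i = g`.
It is also `g` times row `i` of `A` minus a combination of the others, so that difference has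
squared norm `1/g`, which bounds the distance from above. -/
theorem inv_apply_self_re_le_inv_rowSqDist {m n : ℕ} {A : Matrix (Fin m) (Fin n) ℂ}
    (hA : ∀ i, 0 < rowSqDist i A) (i : Fin m) :
    ((A * Aᴴ)⁻¹ i i).re ≤ (rowSqDist i A)⁻¹ := by
  have hW := posDef_mul_conjTranspose_of_rowSqDist_pos hA
  have hWi := hW.inv
  have hdet : IsUnit (A * Aᴴ).det := (Matrix.isUnit_iff_isUnit_det _).1 hW.isUnit
  set B := (A * Aᴴ)⁻¹ with hB
  have hg : 0 < B i i := hWi.diag_pos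
  set g := (B i i).re with hgdef
  have hgi : B i i = (g : ℂ) := Complex.ext rfl (Complex.pos_iff.1 hg).2.symm
  have hg0 : 0 < g := (Complex.pos_iff.1 hg).1
  have hgc : (g : ℂ) ≠ 0 := by exact_mod_cast hg0.ne'
  have hnorm : ‖(WithLp.toLp 2 ((B * A) i) : EuclideanSpace ℂ (Fin n))‖ ^ 2 = g := by
    have h1 : (B * A * (B * A)ᴴ) i i = g := by
      rw [Matrix.conjTranspose_mul, hWi.isHermitian.eq, Matrix.mul_assoc, ← Matrix.mul_assoc A,
        ← Matrix.mul_assoc B, hB, Matrix.nonsing_inv_mul _ hdet, Matrix.one_mul, ← hB, hgi]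
    have h2 : ((‖(WithLp.toLp 2 ((B * A) i) : EuclideanSpace ℂ (Fin n))‖ ^ 2 : ℝ) : ℂ) = g := by
      rw [← h1, EuclideanSpace.norm_sq_eq, Matrix.mul_apply]
      push_cast
      refine Finset.sum_congr rfl fun j _ => ?_
      rw [Matrix.conjTranspose_apply]
      exact (Complex.mul_conj' _).symm
    exact_mod_cast h2
  have hrow : (B * A) i = (g : ℂ) •
      (A i - ∑ j ∈ Finset.univ.erase i, (-(B i j / g)) • A j) := by
    have h0 : (B * A) i = ∑ j, B i j • A j := by
      ext k
      simp [Matrix.mul_apply, Finset.sum_apply]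
    rw [h0, ← Finset.add_sum_erase _ _ (Finset.mem_univ i), hgi, smul_sub, sub_eq_add_neg,
      Finset.smul_sum, ← Finset.sum_neg_distrib]
    congr 1
    refine Finset.sum_congr rfl fun j _ => ?_
    rw [smul_smul, ← neg_smul]
    congr 1
    field_simp
  have h := rowSqDist_le i A fun j => -(B i j / g)
  rw [hrow, WithLp.toLp_smul, norm_smul, mul_pow, Complex.norm_real, Real.norm_eq_abs,
    sq_abs] at hnorm
  rw [le_inv_comm₀ hg0 (hA i)]
  refine h.trans (le_of_eq ?_)
  refine eq_inv_of_mul_eq_one_left ?_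
  have : g * (g * ‖(WithLp.toLp 2 (A i - ∑ j ∈ Finset.univ.erase i, (-(B i j / g)) • A j) :
      EuclideanSpace ℂ (Fin n))‖ ^ 2) = g * 1 := by linarith
  have := mul_left_cancel₀ hg0.ne' this
  linarith

theorem measurable_inv_mul_conjTranspose {m n : ℕ} :
    Measurable fun A : Matrix (Fin m) (Fin n) ℂ => (A * Aᴴ)⁻¹ := by
  have hW : Continuous fun A : Matrix (Fin m) (Fin n) ℂ => A * Aᴴ :=
    continuous_id.matrix_mul continuous_id.matrix_conjTranspose
  have h : (fun A : Matrix (Fin m) (Fin n) ℂ => (A * Aᴴ)⁻¹)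
      = fun A => ((A * Aᴴ).det)⁻¹ • (A * Aᴴ).adjugate := by
    ext A : 1
    rw [Matrix.inv_def, Ring.inverse_eq_inv']
  rw [h]
  refine measurable_pi_lambda _ fun i => measurable_pi_lambda _ fun j => ?_
  have h1 : Measurable fun A : Matrix (Fin m) (Fin n) ℂ => (A * Aᴴ).adjugate i j :=
    (hW.matrix_adjugate.matrix_elem i j).measurable
  exact (hW.matrix_det.measurable.inv).mul h1

theorem re_trace_inv_le {m n : ℕ} {A : Matrix (Fin m) (Fin n) ℂ}
    (hA : ∀ i, 0 < rowSqDist i A) :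
    ((A * Aᴴ)⁻¹.trace).re ≤ ∑ i, (rowSqDist i A)⁻¹ := by
  rw [Matrix.trace, Complex.re_sum]
  exact Finset.sum_le_sum fun i _ => inv_apply_self_re_le_inv_rowSqDist hA i

/-! ### Power control by channel inversion -/

theorem log_det_one_add_smul_one_re (m : ℕ) (q : ℝ) :
    Real.log ((1 + (q : ℂ) • (1 : Matrix (Fin m) (Fin m) ℂ)).det.re) = m * Real.log (1 + q) := by
  have : (1 + (q : ℂ) • (1 : Matrix (Fin m) (Fin m) ℂ)) = ((1 + q : ℝ) : ℂ) • 1 := by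
    push_cast
    rw [add_smul, one_smul]
  rw [this, Matrix.det_smul, Matrix.det_one, mul_one, Fintype.card_fin, ← Complex.ofReal_pow,
    Complex.ofReal_re, Real.log_pow]

/-- Channel inversion on a set `G` of full-rank channels bounds the optimal outage probability. The
covariance matrix `q • S H` turns the channel into a multiple of the identity. -/
theorem optimalOutage_le_of_inversion {M N m n : ℕ} {P q R : ℝ} (hm : 0 < m) (hq : 0 < q)
    {G : Set (Matrix (Fin m) (Fin n) ℂ)} (hG : MeasurableSet G)
    (hpos : ∀ A ∈ G, ∀ i, 0 < rowSqDist i A)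
    (hpow : ∑ i, ∫⁻ A in G, ENNReal.ofReal (q * (rowSqDist i A)⁻¹) ∂channelLaw m n
      ≤ ENNReal.ofReal P)
    (hR : R ≤ m * Real.log (1 + q))
    (f : Matrix (Fin N) (Fin M) ℂ → Matrix (Fin m) (Fin n) ℂ)
    (hf : MeasurePreserving f (channelLaw N M) (channelLaw m n))
    (S : Matrix (Fin N) (Fin M) ℂ → Matrix (Fin M) (Fin M) ℂ)
    (hSm : ∀ i j, Measurable fun H => S H i j)
    (hS : ∀ H, (S H).PosSemidef)
    (htr : ∀ H, (∀ i, 0 < rowSqDist i (f H)) → (S H).trace = (f H * (f H)ᴴ)⁻¹.trace)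
    (hdet : ∀ H, (∀ i, 0 < rowSqDist i (f H)) → (1 + H * ((q : ℂ) • S H) * Hᴴ).det
      = (1 + (q : ℂ) • (1 : Matrix (Fin m) (Fin m) ℂ)).det) :
    optimalOutage N M P R ≤ channelLaw m n Gᶜ := by
  classical
  have hfG : MeasurableSet (f ⁻¹' G) := hf.measurable hG
  let Q : Matrix (Fin N) (Fin M) ℂ → Matrix (Fin M) (Fin M) ℂ :=
    fun H => if H ∈ f ⁻¹' G then (q : ℂ) • S H else 0
  have hQ : IsPowerControl N M P Q := by
    refine ⟨fun i j => ?_, fun H => ?_, ?_⟩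
    · have : (fun H => Q H i j) = fun H => if H ∈ f ⁻¹' G then (q : ℂ) * S H i j else 0 := by
        ext H
        by_cases hH : H ∈ f ⁻¹' G <;> simp only [Q, hH, if_true, if_false] <;> rfl
      rw [this]
      exact Measurable.ite hfG ((hSm i j).const_mul _) measurable_const
    · by_cases hH : H ∈ f ⁻¹' G
      · simp only [Q, hH, if_true]
        exact (hS H).smul (by exact_mod_cast hq.le)
      · simp only [Q, hH, if_false]
        exact Matrix.PosSemidef.zero
    · refine le_trans ?_ hpow
      have hmeas (i : Fin m) : Measurable fun A : Matrix (Fin m) (Fin n) ℂ =>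
          ENNReal.ofReal (q * (rowSqDist i A)⁻¹) :=
        ENNReal.measurable_ofReal.comp ((measurable_rowSqDist i).inv.const_mul q)
      have hsum : Measurable fun A : Matrix (Fin m) (Fin n) ℂ =>
          ∑ i, ENNReal.ofReal (q * (rowSqDist i A)⁻¹) :=
        Finset.measurable_fun_sum _ fun i _ => hmeas i
      rw [← lintegral_finsetSum _ fun i _ => hmeas i, ← hf.setLIntegral_comp_preimage hG hsum,
        ← lintegral_indicator hfG]
      refine lintegral_mono fun H => ?_
      by_cases hH : H ∈ f ⁻¹' G
      · have hp : ∀ i, 0 < rowSqDist i (f H) := hpos _ hH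
        rw [Set.indicator_of_mem hH, ← ENNReal.ofReal_sum_of_nonneg
          fun i _ => mul_nonneg hq.le (inv_nonneg.2 (hp i).le)]
        refine ENNReal.ofReal_le_ofReal ?_
        simp only [Q, hH, if_true]
        rw [Matrix.trace_smul, htr H hp, smul_eq_mul, Complex.re_ofReal_mul, ← Finset.mul_sum]
        exact mul_le_mul_of_nonneg_left (re_trace_inv_le hp) hq.le
      · simp only [Q, hH, if_false]
        simp
  refine (iInf₂_le Q hQ).trans ?_
  rw [← hf.measure_preimage hG.compl.nullMeasurableSet]
  refine measure_mono fun H hH => ?_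
  by_contra hHG
  have hHG : H ∈ f ⁻¹' G := not_not.1 hHG
  have hp : ∀ i, 0 < rowSqDist i (f H) := hpos _ hHG
  have hQH : Q H = (q : ℂ) • S H := by simp only [Q, hHG, if_true]
  -- Silence on `G` is impossible: the trace of the covariance is `q` times that of a positive
  -- definite matrix of size `m > 0`.
  rcases hH with h0 | hlt
  · have htr0 : (S H).trace = 0 := by
      have : ((q : ℂ) • S H).trace = 0 := by rw [← hQH, h0, Matrix.trace_zero]
      rw [Matrix.trace_smul, smul_eq_mul] at this
      exact (mul_eq_zero.1 this).resolve_left (by exact_mod_cast hq.ne')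
    have : Nonempty (Fin m) := ⟨⟨0, hm⟩⟩
    have := (posDef_mul_conjTranspose_of_rowSqDist_pos hp).inv.trace_pos
    rw [← htr H hp, htr0] at this
    exact lt_irrefl _ this
  · rw [mutualInfo, hQH, hdet H hp, log_det_one_add_smul_one_re m q] at hlt
    linarith

/-- Channel inversion for a channel with at least as many transmit as receive antennas. -/
theorem optimalOutage_le_of_rows {m n : ℕ} {P q R : ℝ} (hm : 0 < m) (hq : 0 < q)
    {G : Set (Matrix (Fin m) (Fin n) ℂ)} (hG : MeasurableSet G)
    (hpos : ∀ A ∈ G, ∀ i, 0 < rowSqDist i A)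
    (hpow : ∑ i, ∫⁻ A in G, ENNReal.ofReal (q * (rowSqDist i A)⁻¹) ∂channelLaw m n
      ≤ ENNReal.ofReal P)
    (hR : R ≤ m * Real.log (1 + q)) :
    optimalOutage m n P R ≤ channelLaw m n Gᶜ := by
  have hunit (H : Matrix (Fin m) (Fin n) ℂ) (hH : ∀ i, 0 < rowSqDist i H) :
      IsUnit (H * Hᴴ).det :=
    (Matrix.isUnit_iff_isUnit_det _).1 (posDef_mul_conjTranspose_of_rowSqDist_pos hH).isUnit
  have hherm (H : Matrix (Fin m) (Fin n) ℂ) : ((H * Hᴴ)⁻¹)ᴴ = (H * Hᴴ)⁻¹ :=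
    (Matrix.isHermitian_mul_conjTranspose_self H).inv.eq
  -- The right inverse `Hᴴ (H Hᴴ)⁻¹` is used as precoder, so that `H * S * Hᴴ = 1`.
  refine optimalOutage_le_of_inversion hm hq hG hpos hpow hR id (MeasurePreserving.id _)
    (fun H => ((H * Hᴴ)⁻¹ * H)ᴴ * ((H * Hᴴ)⁻¹ * H)) (fun i j => ?_)
    (fun H => Matrix.posSemidef_conjTranspose_mul_self _) (fun H hH => ?_) (fun H hH => ?_)
  · have hB (a : Fin m) (b : Fin n) :
        Measurable fun H : Matrix (Fin m) (Fin n) ℂ => ((H * Hᴴ)⁻¹ * H) a b := by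
      simp only [Matrix.mul_apply (M := (_ * _)⁻¹)]
      refine Finset.measurable_fun_sum _ fun k _ => Measurable.mul ?_ ?_
      · exact (measurable_pi_apply k).comp ((measurable_pi_apply a).comp
          measurable_inv_mul_conjTranspose)
      · exact (measurable_pi_apply b).comp (measurable_pi_apply k)
    simp only [Matrix.mul_apply (M := (_ * _)ᴴ), Matrix.conjTranspose_apply]
    exact Finset.measurable_fun_sum _ fun k _ =>
      (Complex.continuous_conj.measurable.comp (hB k i)).mul (hB k j)
  · dsimp only [id]
    rw [Matrix.trace_mul_comm, Matrix.conjTranspose_mul, hherm, Matrix.mul_assoc,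
      ← Matrix.mul_assoc H, Matrix.mul_nonsing_inv _ (hunit H hH), Matrix.mul_one]
  · congr 2
    have : H * ((H * Hᴴ)⁻¹ * H)ᴴ = 1 := by
      rw [Matrix.conjTranspose_mul, hherm, ← Matrix.mul_assoc,
        Matrix.mul_nonsing_inv _ (hunit H hH)]
    rw [Matrix.mul_smul, Matrix.smul_mul, ← Matrix.mul_assoc, this, Matrix.one_mul,
      Matrix.mul_assoc, Matrix.nonsing_inv_mul _ (hunit H hH)]

/-- Channel inversion for a channel with at least as many receive as transmit antennas. -/
theorem optimalOutage_le_of_columns {m n : ℕ} {P q R : ℝ} (hm : 0 < m) (hq : 0 < q)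
    {G : Set (Matrix (Fin m) (Fin n) ℂ)} (hG : MeasurableSet G)
    (hpos : ∀ A ∈ G, ∀ i, 0 < rowSqDist i A)
    (hpow : ∑ i, ∫⁻ A in G, ENNReal.ofReal (q * (rowSqDist i A)⁻¹) ∂channelLaw m n
      ≤ ENNReal.ofReal P)
    (hR : R ≤ m * Real.log (1 + q)) :
    optimalOutage n m P R ≤ channelLaw m n Gᶜ := by
  have hgram (H : Matrix (Fin n) (Fin m) ℂ) : Hᴴ * H = (Hᵀ * (Hᵀ)ᴴ)ᵀ := by
    rw [Matrix.transpose_mul, Matrix.transpose_transpose]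
    rfl
  have hunit (H : Matrix (Fin n) (Fin m) ℂ) (hH : ∀ i, 0 < rowSqDist i Hᵀ) :
      IsUnit (Hᴴ * H).det := by
    rw [hgram, Matrix.det_transpose]
    exact (Matrix.isUnit_iff_isUnit_det _).1 (posDef_mul_conjTranspose_of_rowSqDist_pos hH).isUnit
  have hmt : Measurable (Matrix.transpose : Matrix (Fin n) (Fin m) ℂ → _) :=
    continuous_id.matrix_transpose.measurable
  -- Here `H * S * Hᴴ` is only a projection of rank `m`; Sylvester's determinant identity reduces to
  -- `S * (Hᴴ * H) = 1`.
  refine optimalOutage_le_of_inversion hm hq hG hpos hpow hR Matrix.transpose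
    ⟨hmt, map_transpose_channelLaw m n⟩ (fun H => (Hᴴ * H)⁻¹) (fun i j => ?_)
    (fun H => (Matrix.posSemidef_conjTranspose_mul_self H).inv) (fun H hH => ?_) (fun H hH => ?_)
  · simp only [hgram, ← Matrix.transpose_nonsing_inv, Matrix.transpose_apply]
    exact (measurable_pi_apply i).comp ((measurable_pi_apply j).comp
      (measurable_inv_mul_conjTranspose.comp hmt))
  · rw [hgram, ← Matrix.transpose_nonsing_inv, Matrix.trace_transpose]
  · rw [Matrix.mul_assoc, Matrix.det_one_add_mul_comm, Matrix.mul_assoc, Matrix.smul_mul,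
      Matrix.nonsing_inv_mul _ (hunit H hH)]

/-! ### Asymptotics in the power -/

/-- A function that decays faster than every power of `P` has infinite diversity order. -/
theorem hasDiversityOrder_top {p : ℝ → ℝ≥0∞}
    (h : ∀ K : ℕ, ∀ᶠ P : ℝ in atTop, p P ≤ ENNReal.ofReal (P ^ K)⁻¹) :
    HasDiversityOrder p ⊤ := by
  refine EReal.tendsto_nhds_top_iff_real.2 fun x => ?_
  obtain ⟨K, hK⟩ := exists_nat_gt x
  filter_upwards [h K, eventually_gt_atTop 1] with P hP hP1
  have hlog : 0 < Real.log P := Real.log_pos hP1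
  have h1 : ENNReal.log (p P) ≤ ((-(K * Real.log P) : ℝ) : EReal) := by
    refine (ENNReal.log_monotone hP).trans (le_of_eq ?_)
    rw [ENNReal.log_ofReal_of_pos (by positivity), Real.log_inv, Real.log_pow]
  have h2 : ((K * Real.log P : ℝ) : EReal) ≤ -ENNReal.log (p P) := by
    rw [EReal.le_neg, ← EReal.coe_neg]
    exact h1
  refine lt_of_lt_of_le (EReal.coe_lt_coe_iff.2 hK) ?_
  rw [EReal.le_div_iff_mul_le (by exact_mod_cast hlog) (EReal.coe_ne_top _), ← EReal.coe_mul]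
  exact h2

theorem measurableSet_forall_rowSqDist {m n : ℕ} {s : Set ℝ} (hs : MeasurableSet s) :
    MeasurableSet {A : Matrix (Fin m) (Fin n) ℂ | ∀ i, rowSqDist i A ∈ s} := by
  rw [Set.ofPred_forall]
  exact MeasurableSet.iInter fun i => measurable_rowSqDist i hs

theorem channelLaw_compl_forall_le {m n : ℕ} {s : Set ℝ} {c : ℝ≥0∞}
    (h : ∀ i, channelLaw m n {A | rowSqDist i A ∉ s} ≤ c) :
    channelLaw m n {A | ∀ i, rowSqDist i A ∈ s}ᶜ ≤ m * c := by
  have : {A : Matrix (Fin m) (Fin n) ℂ | ∀ i, rowSqDist i A ∈ s}ᶜ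
      = ⋃ i, {A | rowSqDist i A ∉ s} := by
    ext A
    simp
  rw [this]
  refine (measure_iUnion_fintype_le _ _).trans ((Finset.sum_le_sum fun i _ => h i).trans ?_)
  simp

/-- The bounds on the optimal outage probability obtained from channel inversion. -/
def IsInversionBounded (m n : ℕ) (p : ℝ → ℝ → ℝ≥0∞) : Prop :=
  ∀ (P q R : ℝ) (G : Set (Matrix (Fin m) (Fin n) ℂ)), 0 < q → MeasurableSet G →
    (∀ A ∈ G, ∀ i, 0 < rowSqDist i A) →
    ∑ i, ∫⁻ A in G, ENNReal.ofReal (q * (rowSqDist i A)⁻¹) ∂channelLaw m n ≤ ENNReal.ofReal P →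
    R ≤ m * Real.log (1 + q) → p P R ≤ channelLaw m n Gᶜ

theorem isInversionBounded_optimalOutage {M N : ℕ} (hM : 0 < M) (hN : 0 < N) :
    IsInversionBounded (min M N) (max M N) (optimalOutage N M) := by
  intro P q R G hq hG hpos hpow hR
  rcases le_total M N with h | h
  -- The type of `G` contains `min M N` and `max M N`, so `G` must be generalized before rewriting.
  · revert G
    rw [min_eq_left h, max_eq_right h] at *
    intro G hG hpos hpow
    exact optimalOutage_le_of_columns hM hq hG hpos hpow hR
  · revert G
    rw [min_eq_right h, max_eq_left h] at *
    intro G hG hpos hpow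
    exact optimalOutage_le_of_rows hN hq hG hpos hpow hR

theorem sum_lintegral_ofReal_mul_le {m n : ℕ} {q c : ℝ} (hq : 0 ≤ q)
    {G : Set (Matrix (Fin m) (Fin n) ℂ)}
    (h : ∀ i, ∫⁻ A in G, ENNReal.ofReal (rowSqDist i A)⁻¹ ∂channelLaw m n ≤ ENNReal.ofReal c) :
    ∑ i, ∫⁻ A in G, ENNReal.ofReal (q * (rowSqDist i A)⁻¹) ∂channelLaw m n
      ≤ ENNReal.ofReal (m * (q * c)) := by
  have h1 (i : Fin m) : ∫⁻ A in G, ENNReal.ofReal (q * (rowSqDist i A)⁻¹) ∂channelLaw m n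
      ≤ ENNReal.ofReal (q * c) := by
    simp_rw [ENNReal.ofReal_mul hq]
    rw [lintegral_const_mul' _ _ ENNReal.ofReal_ne_top]
    gcongr
    exact h i
  refine (Finset.sum_le_sum fun i _ => h1 i).trans (le_of_eq ?_)
  rw [Finset.sum_const, Finset.card_univ, Fintype.card_fin, nsmul_eq_mul,
    ENNReal.ofReal_mul (Nat.cast_nonneg m), ENNReal.ofReal_natCast]

theorem eventually_mul_rpow_mul_log_le (m K : ℕ) {ρ : ℝ} (hρ : ρ < 1) :
    ∀ᶠ P : ℝ in atTop, m * (P ^ ρ * (2 * Real.log (1 + P ^ (K + 1)))) ≤ P := by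
  have h := ((isLittleO_log_rpow_atTop (sub_pos.2 hρ)).const_mul_left
    (2 * m * (K + 2) : ℝ)).def one_pos
  filter_upwards [h, eventually_ge_atTop 2] with P hP hP2
  have hP0 : 0 < P := by linarith
  rw [one_mul, Real.norm_eq_abs, Real.norm_eq_abs, abs_of_pos (Real.rpow_pos_of_pos hP0 _)] at hP
  have hP := (le_abs_self _).trans hP
  have hlog : Real.log (1 + P ^ (K + 1)) ≤ (K + 2) * Real.log P := by
    have : ((K : ℝ) + 2) * Real.log P = Real.log (P ^ (K + 2)) := by
      rw [Real.log_pow]; push_cast; ring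
    rw [this]
    refine Real.log_le_log (by positivity) ?_
    have h1 : 1 ≤ P ^ (K + 1) := one_le_pow₀ (by linarith)
    rw [pow_succ P (K + 1)]
    nlinarith
  calc m * (P ^ ρ * (2 * Real.log (1 + P ^ (K + 1))))
      ≤ m * (P ^ ρ * (2 * ((K + 2) * Real.log P))) := by gcongr
    _ = P ^ ρ * (2 * m * (K + 2) * Real.log P) := by ring
    _ ≤ P ^ ρ * P ^ (1 - ρ) := by gcongr
    _ = P := by rw [← Real.rpow_add hP0, add_sub_cancel, Real.rpow_one]

theorem IsInversionBounded.hasDiversityOrder_of_lt {m n : ℕ} (hm : 0 < m) (hmn : m ≤ n)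
    {p : ℝ → ℝ → ℝ≥0∞} (hp : IsInversionBounded m n p) {r : ℝ} (hrm : r < m)
    {R : ℝ → ℝ} (hR : HasMultiplexingGain R r) :
    HasDiversityOrder (fun P => p P (R P)) ⊤ := by
  have hm0 : (0 : ℝ) < m := by exact_mod_cast hm
  obtain ⟨s, hrs, hsm⟩ := exists_between hrm
  have hρ : s / m < 1 := (div_lt_one hm0).2 hsm
  refine hasDiversityOrder_top fun K => ?_
  -- Truncating at `P ^ (K + 1)` instead of `P ^ K` leaves a factor `P` that absorbs the constant `m
  -- * e` of the union bound.
  filter_upwards [hR.eventually_lt_const hrs, eventually_mul_rpow_mul_log_le m K hρ,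
    eventually_gt_atTop 1, eventually_ge_atTop (m * Real.exp 1)] with P hRP hPpow hP1 hPm
  have hP0 : 0 < P := by linarith
  have hT : 0 < P ^ (K + 1) := by positivity
  have hq : 0 < P ^ (s / m) := Real.rpow_pos_of_pos hP0 _
  have hinv : 0 < (P ^ (K + 1))⁻¹ := inv_pos.2 hT
  let G : Set (Matrix (Fin m) (Fin n) ℂ) := {A | ∀ i, rowSqDist i A ∈ Set.Ici (P ^ (K + 1))⁻¹}
  have hG : MeasurableSet G := measurableSet_forall_rowSqDist measurableSet_Ici
  have hrate : R P ≤ m * Real.log (1 + P ^ (s / m)) := by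
    rw [div_lt_iff₀ (Real.log_pos hP1)] at hRP
    have h1 : Real.log (P ^ (s / m)) ≤ Real.log (1 + P ^ (s / m)) :=
      Real.log_le_log hq (by linarith)
    rw [Real.log_rpow hP0] at h1
    calc R P ≤ s * Real.log P := hRP.le
      _ = m * (s / m * Real.log P) := by field_simp
      _ ≤ _ := by gcongr
  refine (hp P _ (R P) G hq hG (fun A hA i => hinv.trans_le (hA i)) ?_ hrate).trans ?_
  · refine (sum_lintegral_ofReal_mul_le hq.le fun i => ?_).trans (ENNReal.ofReal_le_ofReal hPpow)
    refine le_trans ?_ (setLIntegral_inv_rowSqDist_le hmn i hT)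
    exact lintegral_mono_set fun A hA => hA i
  · refine (channelLaw_compl_forall_le (c := ENNReal.ofReal (Real.exp 1 / P ^ (K + 1)))
      fun i => ?_).trans ?_
    · simpa only [Set.mem_Ici, not_le] using channelLaw_rowSqDist_lt_le hmn i hT
    · rw [← ENNReal.ofReal_natCast, ← ENNReal.ofReal_mul (Nat.cast_nonneg m)]
      refine ENNReal.ofReal_le_ofReal ?_
      rw [← mul_div_assoc, div_le_iff₀ hT, pow_succ, inv_mul_cancel_left₀ (by positivity)]
      exact hPm

theorem IsInversionBounded.hasDiversityOrder_of_two_mul_lt {m n : ℕ} (hmn : 2 * m < n)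
    {p : ℝ → ℝ → ℝ≥0∞} (hp : IsInversionBounded m n p) :
    HasDiversityOrder (fun P => p P (m * Real.log P)) ⊤ := by
  refine hasDiversityOrder_top fun K => ?_
  filter_upwards [eventually_gt_atTop 1] with P hP1
  have hP0 : 0 < P := by linarith
  let G : Set (Matrix (Fin m) (Fin n) ℂ) := {A | ∀ i, rowSqDist i A ∈ Set.Ioi 0}
  have hG : MeasurableSet G := measurableSet_forall_rowSqDist measurableSet_Ioi
  have hrate : m * Real.log P ≤ m * Real.log (1 + P) := by
    gcongr
    linarith
  refine (hp P P _ G hP0 hG (fun A hA i => hA i) ?_ hrate).trans ?_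
  · refine (sum_lintegral_ofReal_mul_le hP0.le fun i => (setLIntegral_le_lintegral _ _).trans
      (lintegral_inv_rowSqDist_le (by omega) i)).trans (ENNReal.ofReal_le_ofReal ?_)
    have hmn' : 2 * (m : ℝ) < n := by exact_mod_cast hmn
    have hm0 : (0 : ℝ) ≤ m := Nat.cast_nonneg m
    -- The power spent is at most `P * (m / (n - m))`, and `n > 2m` makes the quotient at most `1`.
    rw [mul_left_comm, ← div_eq_mul_inv]
    exact mul_le_of_le_one_right hP0.le ((div_le_one (by linarith)).2 (by linarith))
  · refine (channelLaw_compl_forall_le (c := 0) fun i => ?_).trans (by simp)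
    rw [← channelLaw_rowSqDist_eq_zero (show m ≤ n by omega) i]
    exact measure_mono fun A hA => le_antisymm (not_lt.1 hA) (rowSqDist_nonneg i A)

end MIMO

theorem theorem2 (M N : ℕ) (hM : 0 < M) (hN : 0 < N) (r : ℝ) (hr : 0 ≤ r) :
    (r < (min M N : ℕ) →
      ∀ R : ℝ → ℝ, MIMO.HasMultiplexingGain R r →
        MIMO.HasDiversityOrder (fun P => MIMO.optimalOutage N M P (R P)) ⊤) ∧
    (r = (min M N : ℕ) → 2 * min M N < max M N →
      MIMO.HasDiversityOrder (fun P => MIMO.optimalOutage N M P (r * Real.log P)) ⊤) := by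
  have hp := MIMO.isInversionBounded_optimalOutage hM hN
  refine ⟨fun hrm R hR => hp.hasDiversityOrder_of_lt (lt_min hM hN) min_le_max hrm hR, ?_⟩
  rintro rfl hmn
  exact hp.hasDiversityOrder_of_two_mul_lt hmn
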